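/- Let $q$ be a prime power and let $n \le m$. For matrices over $\mathrm{GF}(q)$ let $R(\cdot)$ denote the row space and let $d_R(X,Y) = \mathrm{rk}(X-Y)$ be the rank distance. Consider an equal row space channel on $\mathrm{GF}(q)^{m\times n}$: the output is the sent matrix plus an error matrix, and errors with the same row space are equiprobable. For a code $\mathcal{C} \subseteq \mathrm{GF}(q)^{m\times n}$, the bounded distance decoder of radius $t$ returns a codeword at rank distance at most $t$ from the received matrix if there is one, and fails otherwise; the decoder error probability $\Pr(C,U,t)$ is the conditional probability that it returns a codeword other than $C$, given that $C\in\mathcal{C}$ was sent and that the error has row space $U \subseteq \mathrm{GF}(q)^n$ (an event assumed to have positive probability). Let $\mathcal{C}$ be any code in $\mathrm{GF}(q)^{m\times n}$ with minimum rank distance $d$ (so $|\mathcal{C}|\ge 2$), let $C \in \mathcal{C}$, let $t = \lfloor (d-1)/2 \rfloor$, and let $U$ be a subspace of $\mathrm{GF}(q)^n$. Let $P_{R,\mathrm{MRD}}(U,t)$ denote the decoder error probability, for any codeword sent, of any maximum rank distance (MRD) code in $\mathrm{GF}(q)^{m\times n}$ with the same minimum rank distance $d$, that is, of any code of maximum cardinality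 among the codes in $\mathrm{GF}(q)^{m\times n}$ with minimum rank distance $d$. Put $H_2 = 3.5$ and $H_q = \frac{q-1}{q-2}$ for $q>2$. If $q>2$, or $n<m$, or $d \ne m-1$, then $$\Pr(C,U,t) \le H_q\, P_{R,\mathrm{MRD}}(U,t),$$ and the inequality is strict whenever $\dim U \ge d-t$. -/

import Mathlib

/-- The row space `R(X)` of a matrix: the subspace of `F ^ n` spanned by its rows. -/
def rowSpace {F : Type*} [Field F] {m n : ℕ} (X : Matrix (Fin m) (Fin n) F) :
    Submodule F (Fin n → F) :=
  Submodule.span F (Set.range fun i => X i)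

/-- The rank distance `rk (X - Y)`. -/
noncomputable def rankDist {F : Type*} [Field F] {m n : ℕ}
    (X Y : Matrix (Fin m) (Fin n) F) : ℕ :=
  (X - Y).rank

/-- The code `𝓒` has minimum rank distance `d`: the smallest distance between two distinct
codewords is attained and equals `d` (in particular `𝓒` has at least two codewords). -/
def HasMinRankDist {F : Type*} [Field F] {m n : ℕ}
    (𝓒 : Finset (Matrix (Fin m) (Fin n) F)) (d : ℕ) : Prop :=
  IsLeast {k : ℕ | ∃ X ∈ 𝓒, ∃ Y ∈ 𝓒, X ≠ Y ∧ rankDist X Y = k} d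

/-- A maximum rank distance code: a code of maximum cardinality among all codes of the same size
of matrices with minimum rank distance `d`. -/
def IsMRD {F : Type*} [Field F] {m n : ℕ}
    (𝓜 : Finset (Matrix (Fin m) (Fin n) F)) (d : ℕ) : Prop :=
  HasMinRankDist 𝓜 d ∧
    ∀ 𝓓 : Finset (Matrix (Fin m) (Fin n) F), HasMinRankDist 𝓓 d → 𝓓.card ≤ 𝓜.card

/-- An equal row space channel. Errors are additive: on input `X` the output is `X + E`, where `E`
has law `errorLaw X`; errors with the same row space are equiprobable. The usual additive channel,
with noise independent of the input, is the case in which `errorLaw` is constant. -/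
structure EqualRowSpaceChannel (F : Type*) [Field F] (m n : ℕ) where
  errorLaw : Matrix (Fin m) (Fin n) F → PMF (Matrix (Fin m) (Fin n) F)
  equiprobable : ∀ X E E' : Matrix (Fin m) (Fin n) F,
    rowSpace E = rowSpace E' → errorLaw X E = errorLaw X E'

open Classical in
/-- The bounded distance decoder of radius `t` for the code `𝓒`: it returns a codeword at rank
distance at most `t` from the received matrix `Y`, and fails (`none`) if there is none. For
`2 * t < d`, with `d` the minimum distance of `𝓒`, this codeword is unique. -/
noncomputable def boundedDistanceDecoder {F : Type*} [Field F] {m n : ℕ}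
    (𝓒 : Finset (Matrix (Fin m) (Fin n) F)) (t : ℕ) (Y : Matrix (Fin m) (Fin n) F) :
    Option (Matrix (Fin m) (Fin n) F) :=
  if h : ∃ D ∈ 𝓒, rankDist Y D ≤ t then some h.choose else none

/-- Decoder error: the decoder returns a codeword different from the sent one. -/
def IsDecoderError {F : Type*} [Field F] {m n : ℕ}
    (𝓒 : Finset (Matrix (Fin m) (Fin n) F)) (t : ℕ) (C Y : Matrix (Fin m) (Fin n) F) : Prop :=
  ∃ D, boundedDistanceDecoder 𝓒 t Y = some D ∧ D ≠ C

/-- The probability that, when `C` is sent over the channel, the error has row space `U`. -/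
noncomputable def rowSpaceProb {F : Type*} [Field F] {m n : ℕ}
    (ch : EqualRowSpaceChannel F m n) (C : Matrix (Fin m) (Fin n) F)
    (U : Submodule F (Fin n → F)) : ℝ :=
  ((ch.errorLaw C).toOuterMeasure {E | rowSpace E = U}).toReal

/-- The decoder error probability `Pr(C, U, t)`: the conditional probability of a decoder error of
the bounded distance decoder of radius `t` for `𝓒`, given that `C` is sent and that the error has
row space `U`. -/
noncomputable def decoderErrorProb {F : Type*} [Field F] {m n : ℕ}
    (ch : EqualRowSpaceChannel F m n) (𝓒 : Finset (Matrix (Fin m) (Fin n) F))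
    (C : Matrix (Fin m) (Fin n) F) (U : Submodule F (Fin n → F)) (t : ℕ) : ℝ :=
  ((ch.errorLaw C).toOuterMeasure
      {E | rowSpace E = U ∧ IsDecoderError 𝓒 t C (C + E)}).toReal / rowSpaceProb ch C U

/-- The constants `H_2 = 3.5` and `H_q = (q - 1) / (q - 2)` for `q > 2`. -/
noncomputable def hConst (q : ℕ) : ℝ :=
  if q = 2 then 3.5 else ((q : ℝ) - 1) / ((q : ℝ) - 2)

/-!
Encode a matrix `X` as a linear map, so that its row space is the annihilator of its kernel, and let
`e + 1` be the minimum distance. Since errors with row space `U` are equiprobable and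
`2 * t < e + 1`, the error probability for a code `𝓒` and a codeword `C` is, up to the number of
matrices with row space `U`, the sum over the codewords `D ≠ C` of `errorCount U t (D - C)`
(`decoderErrorProb_eq`). The summand depends only on the kernel `Z` of `D - C` (`errorCount_congr`),
so it suffices to compare, for each `Z` of dimension less than `n - e`, the number of codewords with
this kernel in `𝓒` and in the MRD code `𝓜`.

For `𝓒` the Singleton bound, applied to the codewords that agree with `C` on `Z`, gives
`Q ^ (l + 1) - 1`, where `Q = q ^ m` and `dim Z + l + 1 + e = n` (`card_filter_ker_eq_le`).
For `𝓜`, which meets the Singleton bound because Gabidulin codes do (`exists_code_card_eq`,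
`IsMRD.card_eq`), the number of codewords that agree with `M` on `Z` is exactly `Q ^ (l + 1)`
(`card_filter_le_ker`), and codewords with a larger kernel are sieved out. A union bound leaves a
fraction of more than `(q - 2) / (q - 1)` (`le_card_filter_ker_eq`), or `1 / 2` if `q = 2` and
`n - dim Z < m`. If `q = 2`, `Z = 0` and `n = m`, inclusion-exclusion up to triples leaves more than
`2 / 7` when `l ≥ 2` (`le_card_filter_ker_eq_bot`); the case `l = 1` is `d = m - 1`, which is
excluded, and for `l = 0` no larger kernel occurs. All these inequalities are strict
(`card_filter_ker_eq_lt`), so the comparison of the sums is strict as soon as some kernel of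
codimension at least `d` has positive weight; such a kernel exists when `d ≤ dim U + t`
(`exists_errorCount_pos`).
-/

open Module

/-! ### Codewords whose difference from a fixed codeword has a given kernel -/

section Codes

variable {F A B : Type*} [Field F] [AddCommGroup A] [Module F A]
  [AddCommGroup B] [Module F B]

theorem Submodule.exists_le_finrank_eq {F A : Type*} [Field F] [AddCommGroup A] [Module F A]
    (W : Submodule F A) {k : ℕ} (hk : k ≤ finrank F W) :
    ∃ Y ≤ W, finrank F Y = k := by
  obtain ⟨f, hf⟩ := exists_linearIndependent_of_le_finrank hk
  refine ⟨(Submodule.span F (Set.range f)).map W.subtype, Submodule.map_subtype_le _ _, ?_⟩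
  rw [Submodule.finrank_map_subtype_eq, finrank_span_eq_card hf, Fintype.card_fin]

open Classical in
theorem card_filter_mem_submodule [Fintype A] (K : Submodule F A) :
    (Finset.univ.filter fun x => x ∈ K).card = Nat.card F ^ finrank F K := by
  rw [← Module.natCard_eq_pow_finrank (K := F) (V := K)]
  exact (Nat.subtype_card _ (by simp)).symm

variable [Finite A] [Finite B]

theorem natCard_linearMap : Nat.card (A →ₗ[F] B) = Nat.card B ^ finrank F A := by
  rw [Module.natCard_eq_pow_finrank (K := F) (V := A →ₗ[F] B),
    Module.natCard_eq_pow_finrank (K := F) (V := B), finrank_linearMap, ← pow_mul, mul_comm]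

/-- Singleton bound, relative to a subspace `Z` on which all codewords agree: if distinct codewords
differ by a map of rank more than `e`, a codeword is determined by its restriction to any subspace
of codimension `e`, hence by its restriction to a complement of `Z` inside one that contains `Z`. -/
theorem card_le_of_agree {S : Finset (A →ₗ[F] B)} {Z : Submodule F A} {e k : ℕ}
    (hdim : finrank F Z + k + e = finrank F A)
    (hZ : ∀ x ∈ S, ∀ y ∈ S, Z ≤ LinearMap.ker (x - y))
    (hS : ∀ x ∈ S, ∀ y ∈ S, x ≠ y → e < finrank F (LinearMap.range (x - y))) :
    S.card ≤ Nat.card B ^ k := by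
  classical
  obtain ⟨W, hW⟩ := Submodule.exists_isCompl Z
  have hWd : finrank F W = k + e := by
    have := Submodule.finrank_add_eq_of_isCompl hW
    omega
  obtain ⟨Y, hYW, hY⟩ := W.exists_le_finrank_eq (k := k) (by omega)
  have hdisj : Disjoint Z Y := hW.disjoint.mono_right hYW
  have hsup : finrank F ↥(Z ⊔ Y) = finrank F Z + k := by
    have := Submodule.finrank_sup_add_finrank_inf_eq Z Y
    rw [hdisj.eq_bot, finrank_bot] at this
    omega
  have hinj : Set.InjOn (fun x : A →ₗ[F] B => x.domRestrict Y) S := by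
    intro x hx y hy hxy
    by_contra hne
    have hYk : Y ≤ LinearMap.ker (x - y) := fun a ha => by
      have := LinearMap.congr_fun hxy ⟨a, ha⟩
      simpa [sub_eq_zero] using this
    have h1 := Submodule.finrank_mono (sup_le (hZ x hx y hy) hYk)
    have h2 := hS x hx y hy hne
    have h3 := LinearMap.finrank_range_add_finrank_ker (x - y)
    omega
  have : Finite (Y →ₗ[F] B) := Finite.of_injective _ DFunLike.coe_injective
  have := Fintype.ofFinite (Y →ₗ[F] B)
  calc S.card = (S.image fun x : A →ₗ[F] B => x.domRestrict Y).card :=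
        (Finset.card_image_of_injOn hinj).symm
    _ ≤ Fintype.card (Y →ₗ[F] B) := Finset.card_le_univ _
    _ = Nat.card B ^ k := by rw [← Nat.card_eq_fintype_card, natCard_linearMap, hY]

open Classical in
/-- In a code that meets the Singleton bound, the number of codewords that agree with `M` on `Z` is
exactly `|B| ^ k`: the classes of codewords with a given restriction to `Z` number at most
`|B| ^ dim Z` and have at most `|B| ^ k` elements each, and these bounds multiply to the size of the
code. -/
theorem card_filter_le_ker {S : Finset (A →ₗ[F] B)} {Z : Submodule F A} {e k : ℕ}
    (hdim : finrank F Z + k + e = finrank F A)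
    (hS : ∀ x ∈ S, ∀ y ∈ S, x ≠ y → e < finrank F (LinearMap.range (x - y)))
    (hcard : S.card = Nat.card B ^ (finrank F A - e)) (M : A →ₗ[F] B) :
    (S.filter fun D => Z ≤ LinearMap.ker (D - M)).card = Nat.card B ^ k := by
  have : Finite (Z →ₗ[F] B) := Finite.of_injective _ DFunLike.coe_injective
  have := Fintype.ofFinite (Z →ₗ[F] B)
  have hker (x y : A →ₗ[F] B) : Z ≤ LinearMap.ker (x - y) ↔ x.domRestrict Z = y.domRestrict Z := by
    constructor
    · intro h
      ext ⟨a, ha⟩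
      simpa [sub_eq_zero] using h ha
    · intro h a ha
      simpa [sub_eq_zero] using LinearMap.congr_fun h ⟨a, ha⟩
  have hle (g : Z →ₗ[F] B) : (S.filter fun D => D.domRestrict Z = g).card ≤ Nat.card B ^ k := by
    refine card_le_of_agree hdim (fun x hx y hy => ?_) fun x hx y hy =>
      hS x (Finset.mem_filter.1 hx).1 y (Finset.mem_filter.1 hy).1
    rw [hker, (Finset.mem_filter.1 hx).2, (Finset.mem_filter.1 hy).2]
  have hsum : ∑ g : Z →ₗ[F] B, (S.filter fun D => D.domRestrict Z = g).card
      = ∑ _g : Z →ₗ[F] B, Nat.card B ^ k := by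
    rw [← Finset.card_eq_sum_card_fiberwise (s := S) (f := fun D => D.domRestrict Z)
      (fun _ _ => Finset.mem_coe.2 (Finset.mem_univ _)), hcard, Finset.sum_const,
      Finset.card_univ, ← Nat.card_eq_fintype_card, natCard_linearMap,
      smul_eq_mul, ← pow_add]
    congr 1
    omega
  have := (Finset.sum_eq_sum_iff_of_le fun g _ => hle g).1 hsum (M.domRestrict Z)
    (Finset.mem_univ _)
  simp_rw [hker]
  exact this

open Classical in
theorem card_filter_ne_le_ker {S : Finset (A →ₗ[F] B)} {Z : Submodule F A} {e k : ℕ}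
    (hdim : finrank F Z + k + e = finrank F A)
    (hS : ∀ x ∈ S, ∀ y ∈ S, x ≠ y → e < finrank F (LinearMap.range (x - y)))
    (hcard : S.card = Nat.card B ^ (finrank F A - e)) {M : A →ₗ[F] B} (hM : M ∈ S) :
    (((S.erase M).filter fun D => Z ≤ LinearMap.ker (D - M)).card : ℝ) =
      (Nat.card B : ℝ) ^ k - 1 := by
  rw [Finset.filter_erase, Finset.cast_card_erase_of_mem (by simp [hM]),
    card_filter_le_ker hdim hS hcard M]
  push_cast
  rfl

open Classical in
/-- In any code, the codewords `D` for which `D - M` has kernel `Z`, together with `M` itself, all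
agree on `Z`, so that the Singleton bound applies to them. -/
theorem card_filter_ker_eq_le {S : Finset (A →ₗ[F] B)} {Z : Submodule F A} {e l : ℕ}
    (hdim : finrank F Z + (l + 1) + e = finrank F A)
    (hS : ∀ x ∈ S, ∀ y ∈ S, x ≠ y → e < finrank F (LinearMap.range (x - y)))
    {M : A →ₗ[F] B} (hM : M ∈ S) :
    ((S.filter fun D => LinearMap.ker (D - M) = Z).card : ℝ) ≤ (Nat.card B : ℝ) ^ (l + 1) - 1 := by
  have hMn : M ∉ S.filter fun D => LinearMap.ker (D - M) = Z := by
    intro h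
    have h2 := (Finset.mem_filter.1 h).2
    rw [sub_self, LinearMap.ker_zero] at h2
    rw [← h2, finrank_top] at hdim
    omega
  have : (insert M (S.filter fun D => LinearMap.ker (D - M) = Z)).card ≤ Nat.card B ^ (l + 1) := by
    have hk : ∀ x ∈ insert M (S.filter fun D => LinearMap.ker (D - M) = Z),
        x ∈ S ∧ Z ≤ LinearMap.ker (x - M) := by
      intro x hx
      rcases Finset.mem_insert.1 hx with rfl | hx
      · simp [hM]
      · exact ⟨(Finset.mem_filter.1 hx).1, (Finset.mem_filter.1 hx).2.ge⟩
    refine card_le_of_agree hdim (fun x hx y hy a ha => ?_) fun x hx y hy =>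
      hS x (hk x hx).1 y (hk y hy).1
    have h1 : x a - M a = 0 := (hk x hx).2 ha
    have h2 : y a - M a = 0 := (hk y hy).2 ha
    rw [LinearMap.mem_ker, LinearMap.sub_apply, sub_eq_zero, sub_eq_zero.1 h1, sub_eq_zero.1 h2]
  rw [Finset.card_insert_of_notMem hMn] at this
  have h : (((S.filter fun D => LinearMap.ker (D - M) = Z).card + 1 : ℕ) : ℝ)
      ≤ ((Nat.card B ^ (l + 1) : ℕ) : ℝ) := by exact_mod_cast this
  push_cast at h
  linarith

open Classical in
/-- Union bound: among the codewords `D ≠ M` that agree with `M` on `Z`, those for which `D - M` has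
a kernel larger than `Z` are few, since such a kernel has at least `(q - 1) * q ^ dim Z` elements
outside `Z`. -/
theorem le_card_filter_ker_eq [Finite F] {S : Finset (A →ₗ[F] B)} {Z : Submodule F A} {e l : ℕ}
    (hdim : finrank F Z + (l + 1) + e = finrank F A)
    (hS : ∀ x ∈ S, ∀ y ∈ S, x ≠ y → e < finrank F (LinearMap.range (x - y)))
    (hcard : S.card = Nat.card B ^ (finrank F A - e)) {M : A →ₗ[F] B} (hM : M ∈ S) :
    ((Nat.card F : ℝ) - 1) * ((Nat.card B : ℝ) ^ (l + 1) - 1) -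
        ((Nat.card F : ℝ) ^ (l + 1 + e) - 1) * ((Nat.card B : ℝ) ^ l - 1) ≤
      ((Nat.card F : ℝ) - 1) * ((S.filter fun D => LinearMap.ker (D - M) = Z).card : ℝ) := by
  obtain ⟨q, hq⟩ : ∃ q, q = Nat.card F := ⟨_, rfl⟩
  rw [← hq]
  have hq0 : (0 : ℝ) < q := by rw [hq]; exact_mod_cast Nat.card_pos
  have hq1 : (1 : ℝ) ≤ q := by rw [hq]; exact_mod_cast Nat.card_pos
  obtain ⟨z, hz⟩ : ∃ z, z = finrank F Z := ⟨_, rfl⟩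
  rw [← hz] at hdim
  obtain ⟨G, hGdef⟩ : ∃ G, G = (S.erase M).filter fun D => Z ≤ LinearMap.ker (D - M) := ⟨_, rfl⟩
  have hmemG (D : A →ₗ[F] B) : D ∈ G ↔ (D ≠ M ∧ D ∈ S) ∧ Z ≤ LinearMap.ker (D - M) := by
    rw [hGdef, Finset.mem_filter, Finset.mem_erase]
  obtain ⟨bad, hbad⟩ : ∃ bad, bad = G.filter fun D => ¬ LinearMap.ker (D - M) = Z := ⟨_, rfl⟩
  have hGood : (G.filter fun D => LinearMap.ker (D - M) = Z)
      = S.filter fun D => LinearMap.ker (D - M) = Z := by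
    ext D
    simp only [hmemG, Finset.mem_filter]
    refine ⟨fun h => ⟨h.1.1.2, h.2⟩, fun h => ⟨⟨⟨?_, h.1⟩, h.2.ge⟩, h.2⟩⟩
    rintro rfl
    have h2 := h.2
    rw [sub_self, LinearMap.ker_zero] at h2
    rw [← h2, finrank_top] at hz
    omega
  have hsplit := Finset.card_filter_add_card_filter_not (s := G)
    (fun D => LinearMap.ker (D - M) = Z)
  rw [hGood, ← hbad] at hsplit
  have hG : (G.card : ℝ) = (Nat.card B : ℝ) ^ (l + 1) - 1 := by
    rw [hGdef]
    exact card_filter_ne_le_ker (by omega) hS hcard hM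
  have := Fintype.ofFinite A
  have hcardsub (K : Submodule F A) :
      ((Finset.univ.filter fun x => x ∈ K).card : ℝ) = (q : ℝ) ^ finrank F K := by
    rw [card_filter_mem_submodule, hq, Nat.cast_pow]
  -- the number of pairs of a map and a kernel vector outside `Z`
  have hpairs : ∑ D ∈ G, ((Finset.univ.filter fun x => x ∉ Z).filter
        fun x => x ∈ LinearMap.ker (D - M)).card
      = ∑ x ∈ Finset.univ.filter (fun x => x ∉ Z),
          (G.filter fun D => x ∈ LinearMap.ker (D - M)).card :=
    Finset.sum_card_bipartiteAbove_eq_sum_card_bipartiteBelow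
      (fun D x => x ∈ LinearMap.ker (D - M))
  have hcompl : ((Finset.univ.filter fun x => x ∉ Z).card : ℝ)
      = (q : ℝ) ^ z * ((q : ℝ) ^ (l + 1 + e) - 1) := by
    have h1 := Finset.card_filter_add_card_filter_not (s := (Finset.univ : Finset A))
      (fun x => x ∈ Z)
    have h2 : (Finset.univ : Finset A).card = q ^ finrank F A := by
      rw [Finset.card_univ, ← Nat.card_eq_fintype_card, hq]
      exact Module.natCard_eq_pow_finrank (K := F)
    have h3 := hcardsub Z
    rw [h2] at h1
    have h4 : ((q ^ finrank F A : ℕ) : ℝ) = _ := congrArg (Nat.cast (R := ℝ)) h1.symm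
    push_cast at h4
    rw [h3, ← hdim, ← hz] at h4
    have h5 : (q : ℝ) ^ (z + (l + 1) + e) = (q : ℝ) ^ z * (q : ℝ) ^ (l + 1 + e) := by
      rw [← pow_add]; congr 1; ring
    linarith
  have hright : (∑ x ∈ Finset.univ.filter (fun x => x ∉ Z),
      ((G.filter fun D => x ∈ LinearMap.ker (D - M)).card : ℝ))
      = (q : ℝ) ^ z * ((q : ℝ) ^ (l + 1 + e) - 1) * ((Nat.card B : ℝ) ^ l - 1) := by
    rw [← hcompl, ← nsmul_eq_mul, ← Finset.sum_const]
    refine Finset.sum_congr rfl fun x hx => ?_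
    have hxZ : x ∉ Z := (Finset.mem_filter.1 hx).2
    have hfr : finrank F ↥(Z ⊔ Submodule.span F {x}) = z + 1 := by
      have h0 : x ≠ 0 := fun h => hxZ (h ▸ Z.zero_mem)
      have hd : Disjoint Z (Submodule.span F {x}) :=
        (Submodule.disjoint_span_singleton' h0).2 hxZ
      have := Submodule.finrank_sup_add_finrank_inf_eq Z (Submodule.span F {x})
      rw [hd.eq_bot, finrank_bot, finrank_span_singleton h0] at this
      omega
    rw [← card_filter_ne_le_ker (Z := Z ⊔ Submodule.span F {x}) (k := l) (by omega) hS hcard hM]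
    congr 2
    ext D
    simp only [hmemG, Finset.mem_filter, Finset.mem_erase, sup_le_iff,
      Submodule.span_singleton_le_iff_mem, and_assoc]
  -- each bad `D` contributes at least `q ^ (z + 1) - q ^ z` such pairs
  have hleft : (bad.card : ℝ) * ((q : ℝ) ^ z * ((q : ℝ) - 1)) ≤
      ∑ D ∈ G, (((Finset.univ.filter fun x => x ∉ Z).filter
        fun x => x ∈ LinearMap.ker (D - M)).card : ℝ) := by
    rw [← nsmul_eq_mul, ← Finset.sum_const, hbad]
    refine (Finset.sum_le_sum fun D hD => ?_).trans
      (Finset.sum_le_sum_of_subset_of_nonneg (Finset.filter_subset _ _) fun _ _ _ =>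
        Nat.cast_nonneg _)
    have hD1 := ((hmemG D).1 (Finset.mem_filter.1 hD).1).2
    have hD2 := (Finset.mem_filter.1 hD).2
    have hlt : Z < LinearMap.ker (D - M) := lt_of_le_of_ne hD1 (Ne.symm hD2)
    have hfl := Submodule.finrank_lt_finrank_of_lt hlt
    have h1 := Finset.card_filter_add_card_filter_not
      (s := Finset.univ.filter fun x => x ∈ LinearMap.ker (D - M)) (fun x => x ∈ Z)
    have h2 : ((Finset.univ.filter fun x => x ∈ LinearMap.ker (D - M)).filter fun x => x ∈ Z)
        = Finset.univ.filter fun x => x ∈ Z := by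
      ext x
      simp only [Finset.mem_filter, Finset.mem_univ, true_and, and_iff_right_iff_imp]
      exact fun hx => hD1 hx
    rw [h2, Finset.filter_comm] at h1
    have h4 := congrArg (Nat.cast (R := ℝ)) h1
    push_cast at h4
    rw [hcardsub, hcardsub, ← hz] at h4
    have h5 : (q : ℝ) ^ (z + 1) ≤ (q : ℝ) ^ finrank F (LinearMap.ker (D - M)) :=
      pow_le_pow_right₀ hq1 (by omega)
    rw [pow_succ] at h5
    linarith
  have hpairs' := congrArg (Nat.cast (R := ℝ)) hpairs
  push_cast at hpairs'
  have hbadle : (bad.card : ℝ) * ((q : ℝ) - 1) ≤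
      ((q : ℝ) ^ (l + 1 + e) - 1) * ((Nat.card B : ℝ) ^ l - 1) := by
    rw [hpairs', hright] at hleft
    refine le_of_mul_le_mul_left ?_ (pow_pos hq0 z)
    linarith
  have hsplit' := congrArg (Nat.cast (R := ℝ)) hsplit
  push_cast at hsplit'
  rw [hG] at hsplit'
  rw [← hsplit']
  linarith

end Codes

/-! ### A three-term sieve for full-rank differences over the field with two elements -/

section Codes

variable {F A B : Type*} [Field F] [AddCommGroup A] [Module F A]
  [AddCommGroup B] [Module F B]

open Classical in
/-- The number of linearly independent `i`-tuples in `K`. For `i > dim K` both sides vanish, the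
product because of its factor with index `dim K`. -/
theorem card_linearIndependent_mem_submodule [Finite F] [Fintype A] (K : Submodule F A) (i : ℕ) :
    ((Finset.univ.filter fun s : Fin i → A =>
        LinearIndependent F s ∧ ∀ j, s j ∈ K).card : ℝ) =
      ∏ j ∈ Finset.range i, ((Nat.card F : ℝ) ^ finrank F K - (Nat.card F : ℝ) ^ j) := by
  have := Fintype.ofFinite F
  by_cases hi : i ≤ finrank F K
  · have h1 : Nat.card {s : Fin i → A // LinearIndependent F s ∧ ∀ j, s j ∈ K} =
        Nat.card {s : Fin i → K // LinearIndependent F s} := by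
      refine Nat.card_congr
        { toFun := fun s => ⟨fun j => ⟨s.1 j, s.2.2 j⟩, ?_⟩
          invFun := fun s => ⟨fun j => (s.1 j : A), ?_, fun j => (s.1 j).2⟩
          left_inv := fun s => rfl
          right_inv := fun s => rfl }
      · exact LinearIndependent.of_comp K.subtype s.2.1
      · exact s.2.map' K.subtype K.ker_subtype
    rw [card_linearIndependent hi] at h1
    have h2 := Nat.subtype_card (p := fun s : Fin i → A => LinearIndependent F s ∧ ∀ j, s j ∈ K)
      (Finset.univ.filter fun s => LinearIndependent F s ∧ ∀ j, s j ∈ K) (by simp)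
    rw [← h2, h1, Nat.cast_prod, Finset.prod_range]
    refine Finset.prod_congr rfl fun j _ => ?_
    rw [Nat.cast_sub (Nat.pow_le_pow_right Fintype.card_pos (by omega)), Nat.card_eq_fintype_card]
    push_cast
    rfl
  · rw [Finset.prod_eq_zero (i := finrank F K) (by simpa using hi) (sub_self _), Nat.cast_eq_zero,
      Finset.card_eq_zero, Finset.filter_eq_empty_iff]
    rintro s - ⟨h1, h2⟩
    have h3 : Submodule.span F (Set.range s) ≤ K :=
      Submodule.span_le.2 (by rintro _ ⟨j, rfl⟩; exact h2 j)
    have h4 := Submodule.finrank_mono h3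
    rw [finrank_span_eq_card h1, Fintype.card_fin] at h4
    exact hi h4

open Classical in
/-- Double counting of the pairs of a codeword `D ≠ M` and a linearly independent `i`-tuple in the
kernel of `D - M`, for a code that meets the Singleton bound. -/
theorem sum_prod_card_ker [Finite F] [Finite A] [Finite B] {S : Finset (A →ₗ[F] B)} {e i k : ℕ}
    (hdim : i + k + e = finrank F A)
    (hS : ∀ x ∈ S, ∀ y ∈ S, x ≠ y → e < finrank F (LinearMap.range (x - y)))
    (hcard : S.card = Nat.card B ^ (finrank F A - e)) {M : A →ₗ[F] B} (hM : M ∈ S) :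
    ∑ D ∈ S.erase M, ∏ j ∈ Finset.range i,
        ((Nat.card F : ℝ) ^ finrank F (LinearMap.ker (D - M)) - (Nat.card F : ℝ) ^ j) =
      (∏ j ∈ Finset.range i, ((Nat.card F : ℝ) ^ finrank F A - (Nat.card F : ℝ) ^ j)) *
        ((Nat.card B : ℝ) ^ k - 1) := by
  obtain ⟨G, hG⟩ : ∃ G, G = S.erase M := ⟨_, rfl⟩
  have hfib (s : Fin i → A) (hs : LinearIndependent F s) :
      ((G.filter fun D => ∀ j, s j ∈ LinearMap.ker (D - M)).card : ℝ) =
        (Nat.card B : ℝ) ^ k - 1 := by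
    have hd : finrank F (Submodule.span F (Set.range s)) = i := by
      rw [finrank_span_eq_card hs, Fintype.card_fin]
    rw [← card_filter_ne_le_ker (Z := Submodule.span F (Set.range s)) (k := k) (by omega) hS hcard
      hM, hG]
    congr 2
    ext D
    simp only [Submodule.span_le, Set.range_subset_iff, SetLike.mem_coe]
  rw [← hG]
  have := Fintype.ofFinite A
  have htop := card_linearIndependent_mem_submodule (⊤ : Submodule F A) i
  rw [finrank_top] at htop
  rw [← htop]
  simp_rw [← card_linearIndependent_mem_submodule, Submodule.mem_top, implies_true, and_true]
  have hpairs := Finset.sum_card_bipartiteAbove_eq_sum_card_bipartiteBelow (s := G)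
      (t := Finset.univ.filter fun s : Fin i → A => LinearIndependent F s)
      (fun D s => ∀ j, s j ∈ LinearMap.ker (D - M))
  have hpairs' := congrArg (Nat.cast (R := ℝ)) hpairs
  push_cast at hpairs'
  rw [← nsmul_eq_mul, ← Finset.sum_const]
  refine Eq.trans ?_ (hpairs'.trans (Finset.sum_congr rfl fun s hs => ?_))
  · refine Finset.sum_congr rfl fun D _ => ?_
    rw [Finset.bipartiteAbove, Finset.filter_filter]
  · exact hfib s (Finset.mem_filter.1 hs).2

open Classical in
/-- Truncated inclusion-exclusion over the field with two elements: for `X = 2 ^ c` the number of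
elements of a kernel, the polynomial
`21 - 21 (X - 1) + 7 (X - 1) (X - 2) - (X - 1) (X - 2) (X - 4)` is `21` at `X = 1` and is
`-(X - 2) (X - 4) (X - 8) ≤ 0` for `c ≥ 1` (the coefficients are `21` times those of the
`2`-binomial Möbius sum, cut after its fourth term). -/
theorem le_card_filter_ker_eq_bot [Finite F] [Finite A] [Finite B] {S : Finset (A →ₗ[F] B)}
    {e l : ℕ} (hF : Nat.card F = 2)
    (hdim : l + 3 + e = finrank F A)
    (hS : ∀ x ∈ S, ∀ y ∈ S, x ≠ y → e < finrank F (LinearMap.range (x - y)))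
    (hcard : S.card = Nat.card B ^ (finrank F A - e)) {M : A →ₗ[F] B} (hM : M ∈ S)
    {a Q : ℝ} (ha : a = 2 ^ finrank F A) (hQ : Q = Nat.card B) :
    21 * (Q ^ (l + 3) - 1) - 21 * ((a - 1) * (Q ^ (l + 2) - 1))
        + 7 * ((a - 1) * (a - 2) * (Q ^ (l + 1) - 1))
        - (a - 1) * (a - 2) * (a - 4) * (Q ^ l - 1) ≤
      21 * ((S.filter fun D => LinearMap.ker (D - M) = ⊥).card : ℝ) := by
  have h0 := sum_prod_card_ker (i := 0) (k := l + 3) (by omega) hS hcard hM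
  have h1 := sum_prod_card_ker (i := 1) (k := l + 2) (by omega) hS hcard hM
  have h2 := sum_prod_card_ker (i := 2) (k := l + 1) (by omega) hS hcard hM
  have h3 := sum_prod_card_ker (i := 3) (k := l) (by omega) hS hcard hM
  simp only [Finset.prod_range_succ, Finset.prod_range_zero, hF, ← hQ, Nat.cast_ofNat, ← ha,
    one_mul, pow_zero, pow_one] at h0 h1 h2 h3
  have hN : ((S.filter fun D => LinearMap.ker (D - M) = ⊥).card : ℝ) =
      ∑ D ∈ S.erase M, if LinearMap.ker (D - M) = ⊥ then (1 : ℝ) else 0 := by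
    rw [← Finset.sum_filter, Finset.filter_erase, Finset.erase_eq_of_notMem, Finset.sum_const,
      nsmul_one]
    intro h
    have h4 := (Finset.mem_filter.1 h).2
    rw [sub_self, LinearMap.ker_zero] at h4
    have h5 := finrank_top F A
    rw [h4, finrank_bot] at h5
    omega
  rw [show (4 : ℝ) = 2 ^ 2 by norm_num, ← h0, ← h1, ← h2, ← h3, hN, Finset.mul_sum, Finset.mul_sum,
    Finset.mul_sum, Finset.mul_sum, ← Finset.sum_sub_distrib, ← Finset.sum_add_distrib,
    ← Finset.sum_sub_distrib]
  refine Finset.sum_le_sum fun D _ => ?_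
  split_ifs with hD
  · rw [hD, finrank_bot]
    norm_num
  · have hc : finrank F (LinearMap.ker (D - M)) ≠ 0 := fun h =>
      hD (Submodule.finrank_eq_zero.1 h)
    obtain ⟨c, hc⟩ := Nat.exists_eq_succ_of_ne_zero hc
    rw [hc]
    obtain ⟨X, hX⟩ : ∃ X : ℝ, X = 2 ^ (c + 1) := ⟨_, rfl⟩
    have key : 0 ≤ (X - 2) * (X - 4) * (X - 8) := by
      by_cases h : c ≤ 1
      · interval_cases c <;> norm_num [hX]
      · have : (8 : ℝ) ≤ X := by
          rw [hX, show (8 : ℝ) = 2 ^ 3 by norm_num]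
          exact pow_le_pow_right₀ (by norm_num) (by omega)
        refine mul_nonneg (mul_nonneg ?_ ?_) ?_ <;> linarith
    rw [Nat.succ_eq_add_one, ← hX]
    linarith

/-- The local comparison. The Singleton bound gives `|B| ^ (l + 1) - 1` for the code `S`. For the
code `T`, of maximal size, the union bound suffices unless `F` has two elements, the maps `D - M`
counted are bijective and `l ≠ 0`; there `l = 1` is excluded by hypothesis, and `l ≥ 2` is covered
by the sieve, whose main term is `6 / 21 = 1 / 3.5`. -/
theorem card_filter_ker_eq_lt [Finite F] [Finite A] [Finite B] {S T : Finset (A →ₗ[F] B)}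
    {Z : Submodule F A} {e l : ℕ} (hdim : finrank F Z + (l + 1) + e = finrank F A)
    (hAB : finrank F A ≤ finrank F B)
    (hcase : 2 < Nat.card F ∨ finrank F A < finrank F B ∨ e + 2 ≠ finrank F B)
    (hS : ∀ x ∈ S, ∀ y ∈ S, x ≠ y → e < finrank F (LinearMap.range (x - y)))
    (hT : ∀ x ∈ T, ∀ y ∈ T, x ≠ y → e < finrank F (LinearMap.range (x - y)))
    (hcard : T.card = Nat.card B ^ (finrank F A - e)) {C M : A →ₗ[F] B} (hC : C ∈ S) (hM : M ∈ T) :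
    ((S.filter fun D => LinearMap.ker (D - C) = Z).card : ℝ) <
      hConst (Nat.card F) * ((T.filter fun D => LinearMap.ker (D - M) = Z).card : ℝ) := by
  have hup := card_filter_ker_eq_le hdim hS hC
  have hlow := le_card_filter_ker_eq hdim hT hcard hM
  have hbot := fun (l' : ℕ) (hl : l = l' + 2) (hF : Nat.card F = 2) (hZ : finrank F Z = 0) =>
    le_card_filter_ker_eq_bot (l := l') hF (by omega) hT hcard hM rfl rfl
  have hB : (Nat.card B : ℝ) = (Nat.card F : ℝ) ^ finrank F B := by
    exact_mod_cast Module.natCard_eq_pow_finrank (K := F) (V := B)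
  refine hup.trans_lt ?_
  clear hup
  have hq2 : 2 ≤ Nat.card F := Finite.one_lt_card
  have hq2' : (2 : ℝ) ≤ Nat.card F := by exact_mod_cast hq2
  have hB2 : (2 : ℝ) ≤ Nat.card B := by
    rw [hB]
    refine hq2'.trans (le_self_pow₀ (by linarith) (by omega))
  have hP (j : ℕ) : (1 : ℝ) ≤ (Nat.card B : ℝ) ^ j := one_le_pow₀ (by linarith)
  rcases hq2.eq_or_lt with hq | hq
  · rw [← hq, hConst, if_pos rfl]
    rw [← hq, Nat.cast_ofNat] at hlow hB
    by_cases hl : l = 0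
    · subst hl
      norm_num at hlow ⊢
      linarith
    by_cases hv : l + 1 + e < finrank F B
    · have h1 : (2 : ℝ) * 2 ^ (l + 1 + e) ≤ Nat.card B := by
        rw [hB, ← pow_succ']
        exact pow_le_pow_right₀ (by norm_num) hv
      have h2 : ((2 : ℝ) ^ (l + 1 + e) - 1) * ((Nat.card B : ℝ) ^ l - 1)
          ≤ ((Nat.card B : ℝ) / 2 - 1) * ((Nat.card B : ℝ) ^ l - 1) :=
        mul_le_mul_of_nonneg_right (by linarith) (by linarith [hP l])
      rw [pow_succ] at hlow ⊢
      have h3 := hP l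
      have h4 : 0 ≤ ((Nat.card B : ℝ) - 2) * ((Nat.card B : ℝ) ^ l - 1) :=
        mul_nonneg (by linarith) (by linarith)
      linarith
    · have hZ0 : finrank F Z = 0 := by omega
      have hcase' : e + 2 ≠ finrank F B := by
        rcases hcase with h | h | h
        · omega
        · omega
        · exact h
      obtain ⟨l', rfl⟩ : ∃ l', l = l' + 2 := ⟨l - 2, by omega⟩
      have h1 := hbot l' rfl hq.symm hZ0
      rw [← Submodule.finrank_eq_zero.1 hZ0, show finrank F A = finrank F B by omega, ← hB] at h1
      obtain ⟨Q, hQ⟩ : ∃ Q : ℝ, Q = Nat.card B := ⟨_, rfl⟩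
      have h2 := hP l'
      rw [← hQ] at h1 h2 hB2 ⊢
      simp only [pow_add] at h1 ⊢
      obtain ⟨P, hP⟩ : ∃ P : ℝ, P = Q ^ l' := ⟨_, rfl⟩
      rw [← hP] at h1 h2 ⊢
      -- `6` times the claim, after `h1`, is that `P * (7 * Q ^ 2 + 8)` exceeds
      -- `-(Q ^ 3 - 14 * Q ^ 2 + 56 * Q - 58)`; here `P ≥ 1`
      have h3 : 0 < (P - 1) * (7 * Q ^ 2 + 8) + (Q ^ 3 - 7 * Q ^ 2 + 56 * Q - 50) := by
        have h4 : 0 ≤ (P - 1) * (7 * Q ^ 2 + 8) := mul_nonneg (by linarith) (by positivity)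
        have h5 : 0 < Q ^ 3 - 7 * Q ^ 2 + 56 * Q - 50 := by
          nlinarith [mul_nonneg (by linarith : (0:ℝ) ≤ Q) (sq_nonneg (2 * Q - 7))]
        linarith
      norm_num
      linarith
  · rw [hConst, if_neg hq.ne']
    have hq3 : (0 : ℝ) < (Nat.card F : ℝ) - 2 := by
      have : (2 : ℝ) < Nat.card F := by exact_mod_cast hq
      linarith
    rw [div_mul_eq_mul_div, lt_div_iff₀ hq3]
    refine lt_of_lt_of_le ?_ hlow
    have h1 : (Nat.card F : ℝ) ^ (l + 1 + e) ≤ Nat.card B := by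
      rw [hB]
      exact pow_le_pow_right₀ (by linarith) (by omega)
    have h2 : ((Nat.card F : ℝ) ^ (l + 1 + e) - 1) * ((Nat.card B : ℝ) ^ l - 1)
        ≤ ((Nat.card B : ℝ) - 1) * ((Nat.card B : ℝ) ^ l - 1) :=
      mul_le_mul_of_nonneg_right (by linarith) (by linarith [hP l])
    have h3 := hP l
    rw [pow_succ]
    linarith

end Codes

/-! ### Gabidulin codes -/

section Gabidulin

open Polynomial

/-- A nonzero linearized polynomial `∑ i ≤ k, a i * x ^ (q ^ i)` has at most `q ^ k` roots, so it
vanishes on no subspace of dimension more than `k`. -/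
theorem finrank_le_of_linearizedPolynomial_eq_zero {F K A : Type*} [Field F] [Finite F]
    [Field K] [Algebra F K] [AddCommGroup A] [Module F A] [Finite A] {ι : A →ₗ[F] K}
    (hι : Function.Injective ι) {k : ℕ} {a : Fin (k + 1) → K} (ha : a ≠ 0) (W : Submodule F A)
    (hW : ∀ x ∈ W, ∑ i, a i * ι x ^ Nat.card F ^ (i : ℕ) = 0) : finrank F W ≤ k := by
  classical
  have hq : 1 < Nat.card F := Finite.one_lt_card
  obtain ⟨p, hp⟩ : ∃ p : K[X], p = ∑ i, C (a i) * X ^ Nat.card F ^ (i : ℕ) := ⟨_, rfl⟩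
  have hp0 : p ≠ 0 := by
    obtain ⟨i, hi⟩ := Function.ne_iff.1 ha
    intro h
    have hc : p.coeff (Nat.card F ^ (i : ℕ)) = a i := by
      rw [hp, finsetSum_coeff, Finset.sum_eq_single i]
      · simp
      · intro j _ hj
        rw [coeff_C_mul, coeff_X_pow, if_neg, mul_zero]
        intro h2
        exact hj (Fin.ext (Nat.pow_right_injective hq h2.symm))
      · simp
    rw [h, coeff_zero] at hc
    exact hi hc.symm
  have hdeg : p.natDegree ≤ Nat.card F ^ k := by
    rw [hp]
    refine natDegree_sum_le_of_forall_le _ _ fun i _ => (natDegree_C_mul_X_pow_le _ _).trans ?_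
    exact Nat.pow_le_pow_right hq.le (by omega)
  have hinj : Function.Injective fun x : W => (⟨ι x, by
      rw [Multiset.mem_toFinset, mem_roots hp0, IsRoot, hp, eval_finsetSum]
      simpa using hW x x.2⟩ : p.roots.toFinset) := by
    intro x y h
    exact Subtype.ext (hι (congrArg Subtype.val h))
  have hle := Nat.card_le_card_of_injective _ hinj
  rw [Module.natCard_eq_pow_finrank (K := F), 
    Nat.card_eq_fintype_card (α := p.roots.toFinset), Fintype.card_coe] at hle
  have := hle.trans ((Multiset.toFinset_card_le _).trans ((card_roots' p).trans hdeg))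
  exact (Nat.pow_le_pow_iff_right hq).1 this

/-- Gabidulin's construction: identify `B` with an extension field `K` of `F`, and `A` with a
subspace of `K`; the linearized polynomials over `K` with at most `dim A - e` terms, restricted to
`A`, form a code that meets the Singleton bound. -/
theorem exists_code_card_eq {F A B : Type*} [Field F] [Finite F] [AddCommGroup A] [Module F A]
    [AddCommGroup B] [Module F B] [Finite A] [Finite B] {e : ℕ}
    (hAB : finrank F A ≤ finrank F B) (he : e < finrank F A) :
    ∃ S : Finset (A →ₗ[F] B), S.card = Nat.card B ^ (finrank F A - e) ∧
      ∀ x ∈ S, ∀ y ∈ S, x ≠ y → e < finrank F (LinearMap.range (x - y)) := by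
  classical
  obtain ⟨p, hp⟩ := CharP.exists F
  have : Fact p.Prime := ⟨CharP.char_is_prime F p⟩
  have : NeZero (finrank F B) := ⟨by omega⟩
  obtain ⟨K, _, _, _, hK⟩ : ∃ (K : Type) (_ : Field K) (_ : Algebra F K) (_ : Finite K),
      finrank F K = finrank F B :=
    ⟨FiniteField.Extension F p (finrank F B), inferInstance, inferInstance, inferInstance,
      FiniteField.finrank_extension F p _⟩
  have := Fintype.ofFinite F
  have := Fintype.ofFinite K
  let L : K ≃ₗ[F] B := LinearEquiv.ofFinrankEq K B hK
  obtain ⟨ι, hι⟩ : ∃ ι : A →ₗ[F] K, Function.Injective ι := by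
    obtain ⟨Y, -, hY⟩ := Submodule.exists_le_finrank_eq (F := F) (⊤ : Submodule F K)
      (k := finrank F A) (by rw [finrank_top]; omega)
    exact ⟨Y.subtype ∘ₗ (LinearEquiv.ofFinrankEq A Y hY.symm).toLinearMap,
      Y.injective_subtype.comp (LinearEquiv.injective _)⟩
  obtain ⟨k, hk⟩ : ∃ k, finrank F A - e = k + 1 := ⟨finrank F A - e - 1, by omega⟩
  let Φ (a : Fin (k + 1) → K) : A →ₗ[F] B := L.toLinearMap ∘ₗ
    (∑ i, LinearMap.mulLeft F (a i) ∘ₗ (FiniteField.frobeniusAlgHom F K ^ (i : ℕ)).toLinearMap) ∘ₗ ι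
  have hΦ (a x) : Φ a x = L (∑ i, a i * ι x ^ Nat.card F ^ (i : ℕ)) := by
    simp [Φ, AlgHom.coe_pow, FiniteField.coe_frobeniusAlgHom, pow_iterate]
  have hker (a b) (hab : a ≠ b) : e < finrank F (LinearMap.range (Φ a - Φ b)) := by
    have h1 := finrank_le_of_linearizedPolynomial_eq_zero hι (sub_ne_zero.2 hab)
      (LinearMap.ker (Φ a - Φ b)) fun x hx => by
        rw [LinearMap.mem_ker, LinearMap.sub_apply, hΦ, hΦ, ← map_sub, L.map_eq_zero_iff,
          ← Finset.sum_sub_distrib] at hx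
        simpa [sub_mul] using hx
    have h2 := LinearMap.finrank_range_add_finrank_ker (Φ a - Φ b)
    omega
  have hinj : Function.Injective Φ := by
    intro a b hab
    by_contra h
    have := hker a b h
    rw [hab, sub_self, LinearMap.range_zero, finrank_bot] at this
    omega
  refine ⟨Finset.univ.image Φ, ?_, ?_⟩
  · rw [Finset.card_image_of_injective _ hinj, hk, Finset.card_univ, Fintype.card_fun,
      Fintype.card_fin, ← Nat.card_eq_fintype_card, Nat.card_congr L.toEquiv]
  · intro x hx y hy hxy
    obtain ⟨a, -, rfl⟩ := Finset.mem_image.1 hx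
    obtain ⟨b, -, rfl⟩ := Finset.mem_image.1 hy
    exact hker a b fun h => hxy (h ▸ rfl)

end Gabidulin

/-! ### Linear maps with equal kernels, and maps close to a given one -/

section LinearMaps

variable {F A B : Type*} [Field F] [AddCommGroup A] [Module F A] [AddCommGroup B] [Module F B]

theorem LinearMap.exists_linearEquiv_comp_eq_of_ker_eq [FiniteDimensional F B] {f g : A →ₗ[F] B}
    (h : LinearMap.ker f = LinearMap.ker g) : ∃ u : B ≃ₗ[F] B, u.toLinearMap ∘ₗ f = g := by
  obtain ⟨P, hP⟩ := Submodule.exists_isCompl (LinearMap.range f)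
  obtain ⟨R, hR⟩ := Submodule.exists_isCompl (LinearMap.range g)
  let v : LinearMap.range f ≃ₗ[F] LinearMap.range g :=
    f.quotKerEquivRange.symm ≪≫ₗ Submodule.quotEquivOfEq _ _ h ≪≫ₗ g.quotKerEquivRange
  have hv (a : A) : (v ⟨f a, a, rfl⟩ : B) = g a := by
    have : f.quotKerEquivRange.symm ⟨f a, a, rfl⟩ = (LinearMap.ker f).mkQ a :=
      f.quotKerEquivRange_symm_apply_image a ⟨a, rfl⟩
    simp [v, this]
  have hd : finrank F P = finrank F R := by
    have h1 := Submodule.finrank_add_eq_of_isCompl hP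
    have h2 := Submodule.finrank_add_eq_of_isCompl hR
    have h3 := v.finrank_eq
    omega
  refine ⟨(Submodule.prodEquivOfIsCompl _ _ hP).symm ≪≫ₗ
    (v.prodCongr (LinearEquiv.ofFinrankEq P R hd)) ≪≫ₗ Submodule.prodEquivOfIsCompl _ _ hR, ?_⟩
  ext a
  have h1 := Submodule.prodEquivOfIsCompl_symm_apply_left _ _ hP ⟨f a, a, rfl⟩
  simp only [LinearMap.comp_apply, LinearEquiv.coe_coe, LinearEquiv.trans_apply]
  rw [h1]
  simp [hv]

/-- As long as the dimensions allow it, a perturbation of rank at most `j` raises the rank of `f` by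
at least `j`. -/
theorem LinearMap.exists_finrank_range_add_le (hAB : finrank F A ≤ finrank F B)
    [FiniteDimensional F A] (f : A →ₗ[F] B) (j : ℕ)
    (hj : finrank F (LinearMap.range f) + j ≤ finrank F A) :
    ∃ g : A →ₗ[F] B, finrank F (LinearMap.range f) + j ≤ finrank F (LinearMap.range g) ∧
      finrank F (LinearMap.range (f - g)) ≤ j := by
  induction j with
  | zero => exact ⟨f, le_rfl, by rw [sub_self, LinearMap.range_zero, finrank_bot]⟩
  | succ j ih =>
    obtain ⟨g, hg1, hg2⟩ := ih (by omega)
    by_cases hg : finrank F (LinearMap.range f) + (j + 1) ≤ finrank F (LinearMap.range g)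
    · exact ⟨g, hg, by omega⟩
    have hk : LinearMap.ker g ≠ ⊥ := fun h => by
      have := LinearMap.finrank_range_add_finrank_ker g
      rw [h, finrank_bot] at this
      omega
    obtain ⟨x, hx, hx0⟩ := Submodule.exists_mem_ne_zero_of_ne_bot hk
    obtain ⟨b, hb⟩ : ∃ b, b ∉ LinearMap.range g := by
      by_contra! h
      have := finrank_top F B
      rw [← Submodule.eq_top_iff'.2 h] at this
      omega
    obtain ⟨φ, -, hφ⟩ := LinearMap.exists_extend_of_notMem (K := F) (p := (⊥ : Submodule F A))
      (v := x) 0 (by simpa using hx0) (1 : F)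
    have hspan : LinearMap.range (φ.smulRight b) ≤ Submodule.span F {b} := by
      rintro _ ⟨a, rfl⟩
      exact Submodule.smul_mem _ _ (Submodule.mem_span_singleton_self b)
    refine ⟨g + φ.smulRight b, ?_, ?_⟩
    · have hbr : b ∈ LinearMap.range (g + φ.smulRight b) :=
        ⟨x, by simp [LinearMap.mem_ker.1 hx, hφ]⟩
      have hlt : LinearMap.range g < LinearMap.range (g + φ.smulRight b) := by
        refine lt_of_le_of_ne ?_ fun h => hb (h ▸ hbr)
        rintro _ ⟨a, rfl⟩
        have h1 := Submodule.sub_mem _ (LinearMap.mem_range_self (g + φ.smulRight b) a)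
          (Submodule.smul_mem _ (φ a) hbr)
        simpa using h1
      have := Submodule.finrank_lt_finrank_of_lt hlt
      omega
    · have h1 : LinearMap.range (f - (g + φ.smulRight b)) ≤
          LinearMap.range (f - g) ⊔ Submodule.span F {b} := by
        rintro _ ⟨a, rfl⟩
        have : (f - (g + φ.smulRight b)) a = (f - g) a - φ.smulRight b a := by
          simp [sub_sub]
        rw [this]
        exact Submodule.sub_mem _ (Submodule.mem_sup_left ⟨a, rfl⟩)
          (Submodule.mem_sup_right (hspan ⟨a, rfl⟩))
      have h2 := Submodule.finrank_mono h1
      have h3 := Submodule.finrank_add_le_finrank_add_finrank (LinearMap.range (f - g))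
        (Submodule.span F {b})
      have h4 := finrank_span_singleton (K := F) (v := b) fun h => hb (h ▸ Submodule.zero_mem _)
      omega

end LinearMaps

/-! ### Counting errors near a given matrix -/

section Matrices

variable {F : Type*} [Field F] {m n : ℕ}

theorem rank_eq_finrank_range_toLin' (X : Matrix (Fin m) (Fin n) F) :
    X.rank = finrank F (LinearMap.range (Matrix.toLin' X)) := rfl

theorem rowSpace_mul_le (P : Matrix (Fin m) (Fin m) F) (X : Matrix (Fin m) (Fin n) F) :
    rowSpace (P * X) ≤ rowSpace X := by
  refine Submodule.span_le.2 ?_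
  rintro _ ⟨i, rfl⟩
  have : (P * X) i = ∑ j, P i j • X j := by
    ext k
    simp [Matrix.mul_apply]
  show (P * X) i ∈ rowSpace X
  rw [this]
  exact Submodule.sum_mem _ fun j _ => Submodule.smul_mem _ _ (Submodule.subset_span ⟨j, rfl⟩)

theorem rowSpace_mul_of_isUnit {P : Matrix (Fin m) (Fin m) F} (hP : IsUnit P)
    (X : Matrix (Fin m) (Fin n) F) : rowSpace (P * X) = rowSpace X := by
  refine le_antisymm (rowSpace_mul_le P X) ?_
  obtain ⟨u, rfl⟩ := hP
  have := rowSpace_mul_le (↑u⁻¹ : Matrix (Fin m) (Fin m) F) ((u : Matrix (Fin m) (Fin m) F) * X)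
  rwa [← Matrix.mul_assoc, Units.inv_mul, Matrix.one_mul] at this

theorem finrank_rowSpace (X : Matrix (Fin m) (Fin n) F) : finrank F (rowSpace X) = X.rank :=
  X.rank_eq_finrank_span_row.symm

theorem Matrix.exists_isUnit_mul_eq_of_ker_eq {X Y : Matrix (Fin m) (Fin n) F}
    (h : LinearMap.ker (Matrix.toLin' X) = LinearMap.ker (Matrix.toLin' Y)) :
    ∃ P : Matrix (Fin m) (Fin m) F, IsUnit P ∧ P * X = Y := by
  obtain ⟨u, hu⟩ := LinearMap.exists_linearEquiv_comp_eq_of_ker_eq h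
  refine ⟨LinearMap.toMatrix' u.toLinearMap, ?_, ?_⟩
  · refine IsUnit.of_mul_eq_one (LinearMap.toMatrix' u.symm.toLinearMap) ?_
    rw [← LinearMap.toMatrix'_comp]
    simp
  · apply Matrix.toLin'.injective
    rw [Matrix.toLin'_mul, Matrix.toLin'_toMatrix', hu]

/-- The number of matrices with row space `U` at rank distance at most `t` from `X`. -/
noncomputable def errorCount (U : Submodule F (Fin n → F)) (t : ℕ)
    (X : Matrix (Fin m) (Fin n) F) : ℕ :=
  Nat.card {E : Matrix (Fin m) (Fin n) F // rowSpace E = U ∧ (E - X).rank ≤ t}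

/-- `errorCount U t X` depends only on the kernel (equivalently, the row space) of `X`: two matrices
with the same kernel differ by an invertible left factor, which preserves row spaces and ranks. -/
theorem errorCount_congr (U : Submodule F (Fin n → F)) (t : ℕ) {X Y : Matrix (Fin m) (Fin n) F}
    (h : LinearMap.ker (Matrix.toLin' X) = LinearMap.ker (Matrix.toLin' Y)) :
    errorCount U t X = errorCount U t Y := by
  obtain ⟨P, hP, rfl⟩ := Matrix.exists_isUnit_mul_eq_of_ker_eq h
  have hPd := (Matrix.isUnit_iff_isUnit_det P).1 hP
  refine Nat.card_congr (Equiv.subtypeEquiv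
    { toFun := fun E => P * E
      invFun := fun E => P⁻¹ * E
      left_inv := fun E => Matrix.nonsing_inv_mul_cancel_left _ _ hPd
      right_inv := fun E => Matrix.mul_nonsing_inv_cancel_left _ _ hPd } fun E => ?_)
  simp only [Equiv.coe_fn_mk, rowSpace_mul_of_isUnit hP, ← Matrix.mul_sub]
  rw [Matrix.rank_mul_eq_right_of_isUnit_det _ _ hPd]

theorem exists_errorCount_pos [Finite F] {d t : ℕ} (hnm : n ≤ m) (hd : d ≤ n)
    {E : Matrix (Fin m) (Fin n) F}
    (h : d ≤ E.rank + t) :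
    ∃ X : Matrix (Fin m) (Fin n) F, d ≤ X.rank ∧ 0 < errorCount (rowSpace E) t X := by
  suffices ∃ X : Matrix (Fin m) (Fin n) F, d ≤ X.rank ∧ (E - X).rank ≤ t by
    obtain ⟨X, h1, h2⟩ := this
    have : Nonempty
        {E' : Matrix (Fin m) (Fin n) F // rowSpace E' = rowSpace E ∧ (E' - X).rank ≤ t} :=
      ⟨E, rfl, h2⟩
    exact ⟨X, h1, Nat.card_pos⟩
  by_cases hE : d ≤ E.rank
  · exact ⟨E, hE, by simp⟩
  obtain ⟨g, hg1, hg2⟩ := LinearMap.exists_finrank_range_add_le (by simpa using hnm)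
    (Matrix.toLin' E) (d - E.rank) (by rw [← rank_eq_finrank_range_toLin']; simp; omega)
  refine ⟨LinearMap.toMatrix' g, ?_, ?_⟩
  · rw [rank_eq_finrank_range_toLin', Matrix.toLin'_toMatrix']
    rw [← rank_eq_finrank_range_toLin'] at hg1
    omega
  · rw [rank_eq_finrank_range_toLin', map_sub, Matrix.toLin'_toMatrix']
    omega

end Matrices

/-! ### Comparing a code of matrices with an MRD code -/

section MatrixCodes

variable {F : Type*} [Field F] {m n d : ℕ} {𝓒 : Finset (Matrix (Fin m) (Fin n) F)}

theorem HasMinRankDist.exists_eq_succ (h : HasMinRankDist 𝓒 d) : ∃ e, d = e + 1 ∧ e < n := by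
  obtain ⟨⟨X, -, Y, -, hne, rfl⟩, -⟩ := h
  have h1 : rankDist X Y ≤ n := Matrix.rank_le_width _
  have h2 : rankDist X Y ≠ 0 := fun h => by
    rw [rankDist, rank_eq_finrank_range_toLin', Submodule.finrank_eq_zero, LinearMap.range_eq_bot,
      LinearEquiv.map_eq_zero_iff, sub_eq_zero] at h
    exact hne h
  exact ⟨rankDist X Y - 1, by omega, by omega⟩

theorem HasMinRankDist.lt_rank {e : ℕ} (h : HasMinRankDist 𝓒 (e + 1)) :
    ∀ X ∈ 𝓒, ∀ Y ∈ 𝓒, X ≠ Y → e < (X - Y).rank :=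
  fun X hX Y hY hne => h.2 ⟨X, hX, Y, hY, hne, rfl⟩

open Classical in
theorem lt_finrank_range_of_lt_rank {e : ℕ} (h : ∀ X ∈ 𝓒, ∀ Y ∈ 𝓒, X ≠ Y → e < (X - Y).rank) :
    ∀ x ∈ 𝓒.image Matrix.toLin', ∀ y ∈ 𝓒.image Matrix.toLin', x ≠ y →
      e < finrank F (LinearMap.range (x - y)) := by
  intro x hx y hy hxy
  obtain ⟨X, hX, rfl⟩ := Finset.mem_image.1 hx
  obtain ⟨Y, hY, rfl⟩ := Finset.mem_image.1 hy
  rw [← map_sub]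
  exact h X hX Y hY fun h => hxy (h ▸ rfl)

theorem card_le_of_lt_rank [Finite F] {e : ℕ} (he : e ≤ n)
    (h : ∀ X ∈ 𝓒, ∀ Y ∈ 𝓒, X ≠ Y → e < (X - Y).rank) :
    𝓒.card ≤ Nat.card (Fin m → F) ^ (n - e) := by
  classical
  rw [← Finset.card_image_of_injective 𝓒 (Matrix.toLin' (R := F)).injective]
  refine card_le_of_agree (Z := ⊥) (e := e) ?_ (fun _ _ _ _ => bot_le)
    (lt_finrank_range_of_lt_rank h)
  rw [finrank_bot, finrank_fin_fun]
  omega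

/-- MRD codes meet the Singleton bound. A Gabidulin code has minimum distance exactly `e + 1`,
because a larger distance would contradict the Singleton bound; so it competes in the definition
of an MRD code. -/
theorem IsMRD.card_eq [Finite F] {e : ℕ} (hnm : n ≤ m) (he : e < n) (h : IsMRD 𝓒 (e + 1)) :
    𝓒.card = Nat.card (Fin m → F) ^ (n - e) := by
  classical
  refine le_antisymm (card_le_of_lt_rank he.le h.1.lt_rank) ?_
  obtain ⟨S, hScard, hS⟩ := exists_code_card_eq (F := F) (A := Fin n → F) (B := Fin m → F) (e := e)
    (by simpa using hnm) (by simpa using he)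
  rw [finrank_fin_fun] at hScard
  obtain ⟨𝓓, h𝓓⟩ : ∃ 𝓓, 𝓓 = S.image LinearMap.toMatrix' := ⟨_, rfl⟩
  have hcard : 𝓓.card = Nat.card (Fin m → F) ^ (n - e) := by
    rw [h𝓓, Finset.card_image_of_injective _ LinearMap.toMatrix'.injective, hScard]
  have hdist : ∀ X ∈ 𝓓, ∀ Y ∈ 𝓓, X ≠ Y → e < (X - Y).rank := by
    intro X hX Y hY hne
    rw [h𝓓] at hX hY
    obtain ⟨x, hx, rfl⟩ := Finset.mem_image.1 hX
    obtain ⟨y, hy, rfl⟩ := Finset.mem_image.1 hY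
    rw [← map_sub, rank_eq_finrank_range_toLin', Matrix.toLin'_toMatrix']
    exact hS x hx y hy fun h => hne (h ▸ rfl)
  rw [← hcard]
  refine h.2 𝓓 ⟨?_, ?_⟩
  · by_contra hnot
    have hB : 1 < Nat.card (Fin m → F) := by
      have : Nonempty (Fin m) := ⟨⟨0, by omega⟩⟩
      exact Finite.one_lt_card
    have hle : 𝓓.card ≤ Nat.card (Fin m → F) ^ (n - (e + 1)) :=
      card_le_of_lt_rank (e := e + 1) he fun X hX Y hY hne =>
        lt_of_le_of_ne (hdist X hX Y hY hne) fun h => hnot ⟨X, hX, Y, hY, hne, h.symm⟩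
    rw [hcard, Nat.pow_le_pow_iff_right hB] at hle
    omega
  · rintro _ ⟨X, hX, Y, hY, hne, rfl⟩
    exact hdist X hX Y hY hne

open Classical in
theorem card_filter_ker_toLin' (C : Matrix (Fin m) (Fin n) F) (Z : Submodule F (Fin n → F)) :
    ((𝓒.image Matrix.toLin').filter fun D => LinearMap.ker (D - Matrix.toLin' C) = Z).card =
      (𝓒.filter fun D => LinearMap.ker (Matrix.toLin' (D - C)) = Z).card := by
  rw [Finset.filter_image, Finset.card_image_of_injective _ (Matrix.toLin' (R := F)).injective]
  simp only [map_sub]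

open Classical in
theorem card_filter_ker_lt_hConst_mul [Finite F] {e : ℕ} (hnm : n ≤ m)
    (hcase : 2 < Nat.card F ∨ n < m ∨ e + 2 ≠ m)
    {𝓒 𝓜 : Finset (Matrix (Fin m) (Fin n) F)} (h𝓒 : HasMinRankDist 𝓒 (e + 1))
    (h𝓜 : IsMRD 𝓜 (e + 1)) {C M : Matrix (Fin m) (Fin n) F} (hC : C ∈ 𝓒) (hM : M ∈ 𝓜)
    {X : Matrix (Fin m) (Fin n) F} (hX : e < X.rank) :
    (((𝓒.erase C).filter fun D =>
        LinearMap.ker (Matrix.toLin' (D - C)) = LinearMap.ker (Matrix.toLin' X)).card : ℝ) <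
      hConst (Nat.card F) * (((𝓜.erase M).filter fun D =>
        LinearMap.ker (Matrix.toLin' (D - M)) = LinearMap.ker (Matrix.toLin' X)).card : ℝ) := by
  have hrn := LinearMap.finrank_range_add_finrank_ker (Matrix.toLin' X)
  rw [← rank_eq_finrank_range_toLin', finrank_fin_fun] at hrn
  -- the omitted codeword is not among those counted, as its difference with itself has kernel `⊤`
  have herase (𝓓 : Finset (Matrix (Fin m) (Fin n) F)) (D : Matrix (Fin m) (Fin n) F) :
      (𝓓.erase D).filter (fun E =>
        LinearMap.ker (Matrix.toLin' (E - D)) = LinearMap.ker (Matrix.toLin' X)) =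
      𝓓.filter fun E =>
        LinearMap.ker (Matrix.toLin' (E - D)) = LinearMap.ker (Matrix.toLin' X) := by
    rw [Finset.filter_erase, Finset.erase_eq_of_notMem]
    intro h
    have h2 := (Finset.mem_filter.1 h).2
    rw [sub_self, map_zero, LinearMap.ker_zero] at h2
    rw [← h2, finrank_top, finrank_fin_fun] at hrn
    omega
  obtain ⟨e', he', hen⟩ := h𝓒.exists_eq_succ
  rw [herase, herase, ← card_filter_ker_toLin', ← card_filter_ker_toLin']
  refine card_filter_ker_eq_lt (e := e) (l := X.rank - (e + 1)) ?_ (by simpa using hnm)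
    (by simpa using hcase) (lt_finrank_range_of_lt_rank h𝓒.lt_rank)
    (lt_finrank_range_of_lt_rank h𝓜.1.lt_rank) ?_ (Finset.mem_image_of_mem _ hC)
    (Finset.mem_image_of_mem _ hM)
  · rw [finrank_fin_fun]
    omega
  · rw [Finset.card_image_of_injective _ (Matrix.toLin' (R := F)).injective, finrank_fin_fun]
    exact h𝓜.card_eq hnm (by omega)

open Classical in
/-- The codewords `D ≠ C` are grouped by the kernel of `D - C`. -/
theorem sum_errorCount_eq [Fintype (Submodule F (Fin n → F))] (U : Submodule F (Fin n → F)) (t : ℕ)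
    {g : Submodule F (Fin n → F) → ℕ}
    (hg : ∀ X : Matrix (Fin m) (Fin n) F, g (LinearMap.ker (Matrix.toLin' X)) = errorCount U t X)
    (𝓒 : Finset (Matrix (Fin m) (Fin n) F)) (C : Matrix (Fin m) (Fin n) F) :
    ∑ D ∈ 𝓒.erase C, errorCount U t (D - C) =
      ∑ Z, ((𝓒.erase C).filter fun D => LinearMap.ker (Matrix.toLin' (D - C)) = Z).card * g Z := by
  rw [← Finset.sum_fiberwise (𝓒.erase C) fun D => LinearMap.ker (Matrix.toLin' (D - C))]
  refine Finset.sum_congr rfl fun Z _ => ?_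
  rw [← smul_eq_mul, ← Finset.sum_const]
  refine Finset.sum_congr rfl fun D hD => ?_
  rw [← (Finset.mem_filter.1 hD).2, hg]

open Classical in
/-- The number of errors with row space `rowSpace E` that bring the received matrix within `t` of a
wrong codeword, for a code of minimum distance `e + 1` and for an MRD code. -/
theorem sum_errorCount_le_and_lt [Finite F] {t e : ℕ} (hnm : n ≤ m)
    (hcase : 2 < Nat.card F ∨ n < m ∨ e + 2 ≠ m)
    {𝓒 𝓜 : Finset (Matrix (Fin m) (Fin n) F)} (h𝓒 : HasMinRankDist 𝓒 (e + 1))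
    (h𝓜 : IsMRD 𝓜 (e + 1)) {C M : Matrix (Fin m) (Fin n) F} (hC : C ∈ 𝓒) (hM : M ∈ 𝓜)
    (E : Matrix (Fin m) (Fin n) F) :
    ((∑ D ∈ 𝓒.erase C, errorCount (rowSpace E) t (D - C) : ℕ) : ℝ) ≤
        hConst (Nat.card F) * (∑ D ∈ 𝓜.erase M, errorCount (rowSpace E) t (D - M) : ℕ) ∧
      (e + 1 ≤ E.rank + t →
        ((∑ D ∈ 𝓒.erase C, errorCount (rowSpace E) t (D - C) : ℕ) : ℝ) <
          hConst (Nat.card F) * (∑ D ∈ 𝓜.erase M, errorCount (rowSpace E) t (D - M) : ℕ)) := by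
  have : Finite (Submodule F (Fin n → F)) := Finite.of_injective _ SetLike.coe_injective
  have := Fintype.ofFinite (Submodule F (Fin n → F))
  obtain ⟨g, hg⟩ : ∃ g : Submodule F (Fin n → F) → ℕ, ∀ X : Matrix (Fin m) (Fin n) F,
      g (LinearMap.ker (Matrix.toLin' X)) = errorCount (rowSpace E) t X := by
    refine ⟨Function.extend (fun X : Matrix (Fin m) (Fin n) F => LinearMap.ker (Matrix.toLin' X))
      (errorCount (rowSpace E) t) 0, fun X => ?_⟩
    have hf : Function.FactorsThrough (errorCount (rowSpace E) t)
        (fun X : Matrix (Fin m) (Fin n) F => LinearMap.ker (Matrix.toLin' X)) :=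
      fun X Y hXY => errorCount_congr _ _ hXY
    exact hf.extend_apply 0 X
  have hnonneg : 0 ≤ hConst (Nat.card F) := by
    have h2 : 2 ≤ Nat.card F := Finite.one_lt_card
    have h2' : (2 : ℝ) ≤ Nat.card F := by exact_mod_cast h2
    rw [hConst]
    split_ifs
    · norm_num
    · exact div_nonneg (by linarith) (by linarith)
  have hterm (Z : Submodule F (Fin n → F)) :
      (((𝓒.erase C).filter fun D => LinearMap.ker (Matrix.toLin' (D - C)) = Z).card : ℝ) * g Z ≤
        hConst (Nat.card F) *
          (((𝓜.erase M).filter fun D => LinearMap.ker (Matrix.toLin' (D - M)) = Z).card * g Z) := by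
    rcases ((𝓒.erase C).filter fun D =>
        LinearMap.ker (Matrix.toLin' (D - C)) = Z).eq_empty_or_nonempty with h | ⟨D, hD⟩
    · rw [h, Finset.card_empty, Nat.cast_zero, zero_mul]
      positivity
    · obtain ⟨h1, rfl⟩ := Finset.mem_filter.1 hD
      rw [← mul_assoc]
      refine mul_le_mul_of_nonneg_right (card_filter_ker_lt_hConst_mul hnm hcase h𝓒 h𝓜 hC hM ?_).le
        (Nat.cast_nonneg _)
      exact h𝓒.lt_rank D (Finset.mem_of_mem_erase h1) C hC (Finset.ne_of_mem_erase h1)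
  rw [sum_errorCount_eq _ _ hg, sum_errorCount_eq _ _ hg]
  push_cast
  rw [Finset.mul_sum]
  refine ⟨Finset.sum_le_sum fun Z _ => hterm Z, fun hE => ?_⟩
  obtain ⟨e', he', hen⟩ := h𝓒.exists_eq_succ
  obtain ⟨X, hX1, hX2⟩ := exists_errorCount_pos (d := e + 1) hnm (by omega) hE
  refine Finset.sum_lt_sum (fun Z _ => hterm Z)
    ⟨LinearMap.ker (Matrix.toLin' X), Finset.mem_univ _, ?_⟩
  rw [← mul_assoc]
  refine mul_lt_mul_of_pos_right (card_filter_ker_lt_hConst_mul hnm hcase h𝓒 h𝓜 hC hM hX1) ?_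
  rw [hg]
  exact_mod_cast hX2

end MatrixCodes

/-! ### Decoder error probabilities as counts -/

section Channel

variable {F : Type*} [Field F] {m n : ℕ}

theorem rank_sub_le_of_rank_sub_le {t : ℕ} {C D D' E : Matrix (Fin m) (Fin n) F}
    (h : (E - (D - C)).rank ≤ t) (h' : (E - (D' - C)).rank ≤ t) : (D - D').rank ≤ 2 * t := by
  rw [rank_eq_finrank_range_toLin'] at h h' ⊢
  have h1 : LinearMap.range (Matrix.toLin' (D - D')) ≤
      LinearMap.range (Matrix.toLin' (E - (D' - C))) ⊔
        LinearMap.range (Matrix.toLin' (E - (D - C))) := by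
    rw [show D - D' = (E - (D' - C)) - (E - (D - C)) by abel, map_sub]
    rintro _ ⟨a, rfl⟩
    exact Submodule.sub_mem _ (Submodule.mem_sup_left ⟨a, rfl⟩) (Submodule.mem_sup_right ⟨a, rfl⟩)
  have h2 := (Submodule.finrank_mono h1).trans (Submodule.finrank_add_le_finrank_add_finrank _ _)
  omega

/-- Below half the minimum distance the codeword chosen by the decoder is the only one in its range,
so the choice in the definition of the decoder plays no role. -/
theorem isDecoderError_iff {e t : ℕ} (ht : 2 * t ≤ e) {𝓒 : Finset (Matrix (Fin m) (Fin n) F)}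
    (h𝓒 : HasMinRankDist 𝓒 (e + 1)) (C E : Matrix (Fin m) (Fin n) F) :
    IsDecoderError 𝓒 t C (C + E) ↔ ∃ D ∈ 𝓒, D ≠ C ∧ (E - (D - C)).rank ≤ t := by
  have hd (D : Matrix (Fin m) (Fin n) F) : rankDist (C + E) D = (E - (D - C)).rank := by
    rw [rankDist]
    congr 1
    abel
  constructor
  · rintro ⟨D, hD, hne⟩
    rw [boundedDistanceDecoder] at hD
    split_ifs at hD with h
    obtain ⟨h1, h2⟩ := h.choose_spec
    rw [Option.some.inj hD] at h1 h2
    exact ⟨D, h1, hne, hd D ▸ h2⟩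
  · rintro ⟨D, hD, hne, hr⟩
    have h : ∃ D ∈ 𝓒, rankDist (C + E) D ≤ t := ⟨D, hD, by rwa [hd]⟩
    refine ⟨h.choose, by rw [boundedDistanceDecoder, dif_pos h], ?_⟩
    obtain ⟨h1, h2⟩ := h.choose_spec
    suffices h.choose = D by rwa [this]
    by_contra hDD
    rw [hd] at h2
    have := rank_sub_le_of_rank_sub_le h2 hr
    have := h𝓒.lt_rank _ h1 D hD hDD
    omega

open Classical in
theorem card_decoderError [Fintype F] {e t : ℕ} (ht : 2 * t ≤ e)
    {𝓒 : Finset (Matrix (Fin m) (Fin n) F)} (h𝓒 : HasMinRankDist 𝓒 (e + 1))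
    (C : Matrix (Fin m) (Fin n) F) (U : Submodule F (Fin n → F)) :
    (Finset.univ.filter fun E : Matrix (Fin m) (Fin n) F =>
        rowSpace E = U ∧ IsDecoderError 𝓒 t C (C + E)).card =
      ∑ D ∈ 𝓒.erase C, errorCount U t (D - C) := by
  have h1 : (Finset.univ.filter fun E : Matrix (Fin m) (Fin n) F =>
        rowSpace E = U ∧ IsDecoderError 𝓒 t C (C + E)) =
      (𝓒.erase C).biUnion fun D => Finset.univ.filter fun E : Matrix (Fin m) (Fin n) F =>
        rowSpace E = U ∧ (E - (D - C)).rank ≤ t := by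
    ext E
    simp only [Finset.mem_filter, Finset.mem_univ, true_and, Finset.mem_biUnion, Finset.mem_erase,
      isDecoderError_iff ht h𝓒]
    constructor
    · rintro ⟨hU, D, hD, hne, hr⟩
      exact ⟨D, ⟨hne, hD⟩, hU, hr⟩
    · rintro ⟨D, ⟨hne, hD⟩, hU, hr⟩
      exact ⟨hU, D, hD, hne, hr⟩
  rw [h1, Finset.card_biUnion]
  · refine Finset.sum_congr rfl fun D _ => ?_
    exact (Nat.subtype_card _ (by simp)).symm
  · intro D hD D' hD' hne
    refine Finset.disjoint_left.2 fun E hE hE' => ?_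
    have h2 := (Finset.mem_filter.1 hE).2.2
    have h3 := (Finset.mem_filter.1 hE').2.2
    have := rank_sub_le_of_rank_sub_le (C := C) h2 h3
    have := h𝓒.lt_rank D (Finset.mem_of_mem_erase hD) D' (Finset.mem_of_mem_erase hD') hne
    omega

/-- An event inside one class of equiprobable errors has a probability proportional to its size. -/
theorem toReal_toOuterMeasure_errorLaw [Fintype F] (ch : EqualRowSpaceChannel F m n)
    (C E₀ : Matrix (Fin m) (Fin n) F) (p : Matrix (Fin m) (Fin n) F → Prop)
    [DecidablePred p] (hp : ∀ E, p E → rowSpace E = rowSpace E₀) :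
    ((ch.errorLaw C).toOuterMeasure {E | p E}).toReal =
      (Finset.univ.filter p).card * (ch.errorLaw C E₀).toReal := by
  have h1 : {E | p E} = ((Finset.univ.filter p : Finset (Matrix (Fin m) (Fin n) F)) :
      Set (Matrix (Fin m) (Fin n) F)) := by
    ext E
    simp
  rw [h1, PMF.toOuterMeasure_apply_finset, Finset.sum_congr rfl fun E hE =>
    ch.equiprobable C E E₀ (hp E (Finset.mem_filter.1 hE).2), Finset.sum_const, nsmul_eq_mul,
    ENNReal.toReal_mul, ENNReal.toReal_natCast]

open Classical in
/-- The decoder error probability is a ratio of cardinalities, in which the channel no longer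
appears. -/
theorem decoderErrorProb_eq [Fintype F] {e t : ℕ} (ht : 2 * t ≤ e)
    {𝓒 : Finset (Matrix (Fin m) (Fin n) F)} (h𝓒 : HasMinRankDist 𝓒 (e + 1))
    (ch : EqualRowSpaceChannel F m n) (C E₀ : Matrix (Fin m) (Fin n) F)
    (hpos : 0 < rowSpaceProb ch C (rowSpace E₀)) :
    decoderErrorProb ch 𝓒 C (rowSpace E₀) t =
      (∑ D ∈ 𝓒.erase C, errorCount (rowSpace E₀) t (D - C) : ℕ) /
        ((Finset.univ.filter fun E : Matrix (Fin m) (Fin n) F =>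
          rowSpace E = rowSpace E₀).card : ℝ) := by
  have h1 : rowSpaceProb ch C (rowSpace E₀) = _ :=
    toReal_toOuterMeasure_errorLaw ch C E₀ (fun E => rowSpace E = rowSpace E₀) fun _ h => h
  rw [h1] at hpos
  rw [decoderErrorProb, h1, toReal_toOuterMeasure_errorLaw ch C E₀ _ fun _ h => h.1,
    card_decoderError ht h𝓒, mul_div_mul_right]
  exact (pos_of_mul_pos_right hpos (Nat.cast_nonneg _)).ne'

end Channel

theorem corollary1 {F : Type*} [Field F] [Fintype F] (m n d t : ℕ) (hnm : n ≤ m)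
    (ht : t = (d - 1) / 2)
    (hcase : 2 < Fintype.card F ∨ n < m ∨ (d : ℤ) ≠ (m : ℤ) - 1)
    (ch : EqualRowSpaceChannel F m n)
    (𝓒 : Finset (Matrix (Fin m) (Fin n) F)) (h𝓒 : HasMinRankDist 𝓒 d)
    (C : Matrix (Fin m) (Fin n) F) (hC : C ∈ 𝓒)
    (𝓜 : Finset (Matrix (Fin m) (Fin n) F)) (h𝓜 : IsMRD 𝓜 d)
    (M : Matrix (Fin m) (Fin n) F) (hM : M ∈ 𝓜)
    (U : Submodule F (Fin n → F))
    (hUC : 0 < rowSpaceProb ch C U) (hUM : 0 < rowSpaceProb ch M U) :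
    decoderErrorProb ch 𝓒 C U t ≤
        hConst (Fintype.card F) * decoderErrorProb ch 𝓜 M U t ∧
      (d ≤ Module.finrank F U + t →
        decoderErrorProb ch 𝓒 C U t <
          hConst (Fintype.card F) * decoderErrorProb ch 𝓜 M U t) := by
  classical
  obtain ⟨e, rfl, hen⟩ := h𝓒.exists_eq_succ
  obtain ⟨E₀, rfl⟩ : ∃ E₀ : Matrix (Fin m) (Fin n) F, rowSpace E₀ = U := by
    by_contra! h
    have hempty : {E : Matrix (Fin m) (Fin n) F | rowSpace E = U} = ∅ :=
      Set.eq_empty_of_forall_notMem h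
    simp [rowSpaceProb, hempty] at hUC
  have hcase' : 2 < Nat.card F ∨ n < m ∨ e + 2 ≠ m := by
    rw [Nat.card_eq_fintype_card]
    refine hcase.imp_right (Or.imp_right fun h => ?_)
    omega
  have hN : (0 : ℝ) < (Finset.univ.filter fun E : Matrix (Fin m) (Fin n) F =>
      rowSpace E = rowSpace E₀).card := by
    exact_mod_cast Finset.card_pos.2 ⟨E₀, by simp⟩
  obtain ⟨hle, hlt⟩ := sum_errorCount_le_and_lt (t := t) hnm hcase' h𝓒 h𝓜 hC hM E₀
  rw [decoderErrorProb_eq (by omega) h𝓒 ch C E₀ hUC,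
    decoderErrorProb_eq (by omega) h𝓜.1 ch M E₀ hUM,
    finrank_rowSpace, ← Nat.card_eq_fintype_card, ← mul_div_assoc]
  exact ⟨div_le_div_of_nonneg_right hle hN.le, fun h => div_lt_div_of_pos_right (hlt h) hN⟩
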